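/- **Theorem.** Let $T$ be an (honest) triangulation of a square, that is, a finite oriented abstract simplicial complex whose geometric realization is homeomorphic to a closed disk and which has exactly four vertices on its boundary, called corners and labelled $\mathbf p,\mathbf q,\mathbf r,\mathbf s$ in the cyclic order determined by the orientation. Let $\Delta_1,\dots,\Delta_n$ be the triangles of $T$, and let $S=\mathbb{Q}(x_v,y_v)$ be the field of rational functions in independent variables $x_v,y_v$, where $v$ runs through all vertices of $T$ except $\mathbf r$. In $S$ set $x_{\mathbf r}=x_{\mathbf q}+x_{\mathbf s}-x_{\mathbf p}$ and $y_{\mathbf r}=y_{\mathbf q}+y_{\mathbf s}-y_{\mathbf p}$. For each triangle $\Delta_j=(u,v,w)$, with its vertices in the cyclic order given by the orientation of $T$, let $$Z_j=\frac12\det\begin{pmatrix}1&1&1\\ x_u&x_v&x_w\\ y_u&y_v&y_w\end{pmatrix}\in S,$$ and let $\sigma=\sum_{j=1}^n Z_j\in S$. Then there exist a non-negative integer $e$ and a polynomial $f_T$ in $n$ variables with integer coefficients, homogeneous of degree $e$, such that $$2f_T(Z_1,\dots,Z_n)=\sigma^e\quad\text{in } S.$$ -/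

import Mathlib

/-- The geometric realization of a finite abstract simplicial complex: the points of the standard
simplex on the vertex set whose barycentric coordinates are supported on a face. -/
def simplicialRealization {V : Type*} [Fintype V] (K : AbstractSimplicialComplex V) :
    Set (V → ℝ) :=
  {w | w ∈ stdSimplex ℝ V ∧ ∃ s ∈ K.faces, ∀ v, w v ≠ 0 → v ∈ s}

/-- For a family of cyclically ordered triangles `(t 0, t 1, t 2)`: `(a, b)` is one of the ordered
edges `(t 0, t 1)`, `(t 1, t 2)`, `(t 2, t 0)` of one of the triangles `t`. -/
def IsOrientedEdge {V : Type*} {n : ℕ} (tri : Fin n → Fin 3 ↪ V) (a b : V) : Prop :=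
  ∃ (j : Fin n) (i : Fin 3), tri j i = a ∧ tri j (i + 1) = b

/-- An (honest) triangulation of a square, with vertex set `V`: an oriented simplicial complex
homeomorphic to a closed disk, with exactly four vertices on its boundary (the corners), labelled
in the cyclic order given by the orientation. The triangles are numbered. -/
structure SquareTriangulation (V : Type*) [Fintype V] where
  /-- the underlying abstract simplicial complex -/
  complex : AbstractSimplicialComplex V
  /-- its geometric realization is homeomorphic to the closed unit disk -/
  disk : Nonempty (simplicialRealization complex ≃ₜ
    Metric.closedBall (0 : EuclideanSpace ℝ (Fin 2)) 1)
  /-- the number of triangles -/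
  n : ℕ
  /-- the triangles; `(tri j 0, tri j 1, tri j 2)` is the cyclic order given by the orientation -/
  tri : Fin n → Fin 3 ↪ V
  /-- the triangles of the list are the 2-dimensional faces, each of them listed exactly once -/
  tri_bijOn : Set.BijOn (fun j => Finset.univ.map (tri j)) Set.univ
    {s | s ∈ complex.faces ∧ s.card = 3}
  /-- the orientation is coherent: two different triangles never induce the same direction on a
  common edge -/
  coherent : ∀ (j j' : Fin n) (i i' : Fin 3), tri j i = tri j' i' →
    tri j (i + 1) = tri j' (i' + 1) → j = j'
  /-- the four corners `p, q, r, s` -/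
  corner : Fin 4 → V
  /-- the corners are distinct -/
  corner_injective : Function.Injective corner
  /-- the boundary of the disk (the edges that lie in only one triangle), with the direction
  induced by the orientation, is the 4-cycle `p → q → r → s → p` -/
  boundary : ∀ a b : V, (IsOrientedEdge tri a b ∧ ¬ IsOrientedEdge tri b a) ↔
    ∃ i : Fin 4, a = corner i ∧ b = corner (i + 1)

namespace SquareTriangulation

variable {V : Type*} [Fintype V]

/-- The polynomial ring over `ℚ` in the variables `x_v, y_v` (second index `0`, `1`), where `v` runs
through all vertices except the corner `r`. -/
abbrev CoordRing (T : SquareTriangulation V) : Type _ :=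
  MvPolynomial ({v : V // v ≠ T.corner 2} × Fin 2) ℚ

/-- The coordinate function field of the space of drawings: the field of rational functions
over `ℚ` in the variables `x_v, y_v`, `v ≠ r`. -/
abbrev FunctionField (T : SquareTriangulation V) : Type _ :=
  FractionRing T.CoordRing

open Classical in
/-- The coordinates `x_v` (`c = 0`) and `y_v` (`c = 1`) of a vertex `v`: variables if `v ≠ r`, and
given by `x_r = x_q + x_s - x_p`, `y_r = y_q + y_s - y_p` for the corner `r`. -/
noncomputable def coord (T : SquareTriangulation V) (c : Fin 2) (v : V) : T.CoordRing :=
  if h : v ≠ T.corner 2 then MvPolynomial.X (⟨v, h⟩, c)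
  else MvPolynomial.X (⟨T.corner 1, T.corner_injective.ne (by decide)⟩, c)
    + MvPolynomial.X (⟨T.corner 3, T.corner_injective.ne (by decide)⟩, c)
    - MvPolynomial.X (⟨T.corner 0, T.corner_injective.ne (by decide)⟩, c)

/-- The quadratic polynomial expressing the (signed) area of the triangle `(u, v, w)`. -/
noncomputable def areaPoly (T : SquareTriangulation V) (u v w : V) : T.CoordRing :=
  MvPolynomial.C (1 / 2 : ℚ) *
    Matrix.det !![1, 1, 1;
      T.coord 0 u, T.coord 0 v, T.coord 0 w;
      T.coord 1 u, T.coord 1 v, T.coord 1 w]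

/-- `Z_j`: the area of the `j`-th triangle, as an element of the function field. -/
noncomputable def Z (T : SquareTriangulation V) (j : Fin T.n) : T.FunctionField :=
  algebraMap T.CoordRing T.FunctionField (T.areaPoly (T.tri j 0) (T.tri j 1) (T.tri j 2))

/-- `σ`: the sum of the areas of all triangles. -/
noncomputable def sigma (T : SquareTriangulation V) : T.FunctionField :=
  ∑ j, T.Z j

end SquareTriangulation

/-! Let `A` be the subring generated over the integers by the ratios `Z j / σ`, with `σ ≠ 0`. If 2
is a unit of `A`, then `2 * g(Z / σ) = 1` for some integer polynomial `g`, and clearing denominators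
gives the homogeneous identity. Otherwise some valuation ring contains `A` and has 2 as a nonunit.
Monsky's argument excludes this: in affine coordinates making the parallelogram a unit square,
Sperner's lemma (`exists_rainbow`) yields a three-coloured triangle, and
`Valuation.one_le_of_planeColor` gives `1 ≤ v (2 * Z j / σ)`. As `v 2 < 1`, the ratio `Z j / σ` lies
outside the valuation ring, a contradiction. -/

open MvPolynomial in
/-- Homogenization with respect to the linear form `∑ i, X i`. -/
theorem exists_isHomogeneous_aeval_eq {ι R K : Type*} [Fintype ι] [CommRing R] [Field K]
    [Algebra R K] (z : ι → K) (hz : ∑ i, z i ≠ 0) (g : MvPolynomial ι R) :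
    ∃ (e : ℕ) (f : MvPolynomial ι R), f.IsHomogeneous e ∧
      aeval z f = (∑ i, z i) ^ e * aeval (fun i => z i / ∑ i, z i) g := by
  set s := ∑ i, z i with hs
  -- Each homogeneous component is padded to the top degree by powers of the linear form.
  refine ⟨g.totalDegree, ∑ k ∈ Finset.range (g.totalDegree + 1),
    (∑ i, X i) ^ (g.totalDegree - k) * homogeneousComponent k g, ?_, ?_⟩
  · refine IsHomogeneous.sum _ _ _ fun k hk => ?_
    have hk' : 1 * (g.totalDegree - k) + k = g.totalDegree := by
      have := Finset.mem_range.1 hk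
      omega
    have h := (IsHomogeneous.sum Finset.univ (fun i => (X i : MvPolynomial ι R)) 1
      fun i _ => isHomogeneous_X R i).pow (g.totalDegree - k)
    simpa only [hk'] using h.mul (homogeneousComponent_isHomogeneous k g)
  · have hsum : aeval (fun i => z i / s) g = ∑ k ∈ Finset.range (g.totalDegree + 1),
        aeval (fun i => z i / s) (homogeneousComponent k g) := by
      rw [← map_sum, sum_homogeneousComponent]
    rw [hsum, map_sum, Finset.mul_sum]
    refine Finset.sum_congr rfl fun k hk => ?_
    have hk' : g.totalDegree - k + k = g.totalDegree := by
      have := Finset.mem_range.1 hk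
      omega
    rw [map_mul, map_pow, map_sum]
    simp only [aeval_X]
    rw [← hs]
    have hs' : s ^ g.totalDegree = s ^ (g.totalDegree - k) * s ^ k := by rw [← pow_add, hk']
    rw [hs', mul_assoc]
    congr 1
    rw [aeval_def, aeval_def, eval₂_eq, eval₂_eq, Finset.mul_sum]
    refine Finset.sum_congr rfl fun d hd => ?_
    have hdeg : ∑ i ∈ d.support, d i = k := by
      have := homogeneousComponent_isHomogeneous k g (mem_support_iff.1 hd)
      rwa [Pi.one_def, ← Finsupp.degree_eq_weight_one] at this
    simp only [div_pow]
    rw [Finset.prod_div_distrib, Finset.prod_pow_eq_pow_sum, hdeg]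
    field_simp

/-! ### Monsky's colouring -/

/-- The three colour classes of points of the plane defined by a valuation. -/
noncomputable def Valuation.planeColor {K Γ : Type*} [Field K] [LinearOrderedCommGroupWithZero Γ]
    (v : Valuation K Γ) (x y : K) : Fin 3 :=
  if v x < 1 ∧ v y < 1 then 0 else if v y ≤ v x then 1 else 2

section PlaneColor

variable {K Γ : Type*} [Field K] [LinearOrderedCommGroupWithZero Γ] (v : Valuation K Γ)

theorem Valuation.planeColor_eq_zero {x y : K} (h : v.planeColor x y = 0) : v x < 1 ∧ v y < 1 := by
  unfold planeColor at h
  split_ifs at h with h1 h2 <;> simp_all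

theorem Valuation.planeColor_eq_one {x y : K} (h : v.planeColor x y = 1) :
    1 ≤ v x ∧ v y ≤ v x := by
  unfold planeColor at h
  split_ifs at h with h1 h2
  · simp at h
  · refine ⟨?_, h2⟩
    by_contra! h3
    exact h1 ⟨h3, h2.trans_lt h3⟩
  · simp at h

theorem Valuation.planeColor_eq_two {x y : K} (h : v.planeColor x y = 2) :
    1 ≤ v y ∧ v x < v y := by
  unfold planeColor at h
  split_ifs at h with h1 h2
  · simp at h
  · simp at h
  · rw [not_le] at h2
    refine ⟨?_, h2⟩
    by_contra! h3
    exact h1 ⟨h2.trans h3, h3⟩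

/-- Monsky's estimate: a triangle whose vertices have three different colours has large area. -/
theorem Valuation.one_le_of_planeColor {x₀ y₀ x₁ y₁ x₂ y₂ : K} (h₀ : v.planeColor x₀ y₀ = 0)
    (h₁ : v.planeColor x₁ y₁ = 1) (h₂ : v.planeColor x₂ y₂ = 2) :
    1 ≤ v ((x₁ - x₀) * (y₂ - y₀) - (x₂ - x₀) * (y₁ - y₀)) := by
  obtain ⟨a0, b0⟩ := v.planeColor_eq_zero h₀
  obtain ⟨a1, b1⟩ := v.planeColor_eq_one h₁
  obtain ⟨a2, b2⟩ := v.planeColor_eq_two h₂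
  have e1 : v (x₁ - x₀) = v x₁ := v.map_sub_eq_of_lt_left (a0.trans_le a1)
  have e2 : v (y₂ - y₀) = v y₂ := v.map_sub_eq_of_lt_left (b0.trans_le a2)
  have e3 : v (x₂ - x₀) < v y₂ := v.map_sub_lt b2 (a0.trans_le a2)
  have e4 : v (y₁ - y₀) ≤ v x₁ := v.map_sub_le b1 (b0.le.trans a1)
  -- One of the two products strictly dominates, so no cancellation can occur.
  have h : v ((x₂ - x₀) * (y₁ - y₀)) < v ((x₁ - x₀) * (y₂ - y₀)) := by
    rw [map_mul, map_mul, e1, e2, mul_comm (v x₁)]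
    exact mul_lt_mul_of_lt_of_le_of_nonneg_of_pos e3 e4 zero_le (zero_lt_one.trans_le a1)
  rw [v.map_sub_eq_of_lt_left h, map_mul, e1, e2]
  exact one_le_mul a1 a2

end PlaneColor

/-! ### Boundary sums and Sperner's lemma -/

namespace SquareTriangulation

variable {V : Type*} [Fintype V] (T : SquareTriangulation V)

theorem orientedEdge_injective :
    Function.Injective fun e : Fin T.n × Fin 3 => (T.tri e.1 e.2, T.tri e.1 (e.2 + 1)) := by
  rintro ⟨j, i⟩ ⟨j', i'⟩ h
  obtain ⟨h1, h2⟩ := Prod.mk.inj h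
  obtain rfl := T.coherent j j' i i' h1 h2
  exact congrArg (Prod.mk j) ((T.tri j).injective h1)

open Classical in
/-- An antisymmetric function of directed edges has the same sum over the boundaries of all
triangles as over the boundary of the square. -/
theorem sum_orientedEdge_eq_sum_boundary {M : Type*} [AddCommGroup M] [IsAddTorsionFree M]
    (g : V → V → M) (hg : ∀ a b, g b a = -g a b) :
    ∑ j, ∑ i, g (T.tri j i) (T.tri j (i + 1)) = ∑ i, g (T.corner i) (T.corner (i + 1)) := by
  set E : Finset (V × V) := Finset.univ.filter fun e => IsOrientedEdge T.tri e.1 e.2 with hE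
  have h1 : ∑ j, ∑ i, g (T.tri j i) (T.tri j (i + 1)) = ∑ e ∈ E, g e.1 e.2 := by
    have : E = Finset.univ.image fun e : Fin T.n × Fin 3 =>
        (T.tri e.1 e.2, T.tri e.1 (e.2 + 1)) := by
      ext ⟨a, b⟩
      simp only [hE, Finset.mem_filter, Finset.mem_univ, true_and]
      simp [IsOrientedEdge]
    rw [this, Finset.sum_image T.orientedEdge_injective.injOn, ← Fintype.sum_prod_type']
  have h2 : ∑ e ∈ E with IsOrientedEdge T.tri e.2 e.1, g e.1 e.2 = 0 := by
    -- Reversing edges shows that the interior sum is its own negative.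
    rw [← self_eq_neg, ← Finset.sum_neg_distrib]
    refine Finset.sum_equiv (Equiv.prodComm V V) (fun e => ?_) fun e _ => ?_
    · simp [hE, and_comm]
    · simp [hg e.1 e.2]
  have h3 : (E.filter fun e => ¬ IsOrientedEdge T.tri e.2 e.1) =
      Finset.univ.image fun i => (T.corner i, T.corner (i + 1)) := by
    ext ⟨a, b⟩
    simp [hE, T.boundary, eq_comm]
  rw [h1, ← Finset.sum_filter_add_sum_filter_not E fun e => IsOrientedEdge T.tri e.2 e.1, h2, h3,
    zero_add, Finset.sum_image]
  intro i _ i' _ h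
  exact T.corner_injective (Prod.mk.inj h).1

/-- The signed number of traversals of the edge between the colours `0` and `1`. -/
def colorStep (a b : Fin 3) : ℤ :=
  if a = 0 ∧ b = 1 then 1 else if a = 1 ∧ b = 0 then -1 else 0

/-- Sperner's lemma for a triangulated square. -/
theorem exists_rainbow (col : V → Fin 3) (hp : col (T.corner 0) = 0) (hq : col (T.corner 1) = 1)
    (hr : col (T.corner 2) = 1) (hs : col (T.corner 3) = 2) :
    ∃ j, Function.Surjective fun i => col (T.tri j i) := by
  -- A closed walk that misses a colour crosses between 0 and 1 equally often each way.
  have key : ∀ c : Fin 3 → Fin 3, ∑ i, colorStep (c i) (c (i + 1)) ≠ 0 →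
      Function.Surjective c := by
    unfold Function.Surjective colorStep
    decide
  have h := T.sum_orientedEdge_eq_sum_boundary (fun a b => colorStep (col a) (col b))
    fun a b => by
      unfold colorStep
      generalize col a = c
      generalize col b = d
      revert c d
      decide
  have h' : ∑ i, colorStep (col (T.corner i)) (col (T.corner (i + 1))) = 1 := by
    rw [Fin.sum_univ_four]
    simp [hp, hq, hr, hs, colorStep]
  rw [h'] at h
  obtain ⟨j, -, hj⟩ := Finset.exists_ne_zero_of_sum_ne_zero (h.trans_ne one_ne_zero)
  exact ⟨j, key _ hj⟩

/-! ### Drawings over a valued field -/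

section Field

variable {K : Type*} [Field K] (x y : V → K)

/-- Twice the signed area of the triangle `abc`. -/
def doubleArea (a b c : V) : K :=
  (x b - x a) * (y c - y a) - (x c - x a) * (y b - y a)

/-- Shoelace formula: interior edges cancel, and the boundary is a parallelogram, twice the triangle
on corners 0, 1, 3. -/
theorem sum_doubleArea [CharZero K]
    (hx : x (T.corner 2) = x (T.corner 1) + x (T.corner 3) - x (T.corner 0))
    (hy : y (T.corner 2) = y (T.corner 1) + y (T.corner 3) - y (T.corner 0)) :
    ∑ j, doubleArea x y (T.tri j 0) (T.tri j 1) (T.tri j 2) =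
      2 * doubleArea x y (T.corner 0) (T.corner 1) (T.corner 3) := by
  have h := T.sum_orientedEdge_eq_sum_boundary (fun a b => x a * y b - x b * y a)
    fun a b => by ring
  calc
    _ = ∑ j, ∑ i,
        (x (T.tri j i) * y (T.tri j (i + 1)) - x (T.tri j (i + 1)) * y (T.tri j i)) := by
        refine Finset.sum_congr rfl fun j _ => ?_
        simp only [Fin.sum_univ_three, doubleArea, zero_add, Fin.reduceAdd]
        ring
    _ = _ := by
        rw [h]
        simp only [Fin.sum_univ_four, doubleArea, zero_add, Fin.reduceAdd, hx, hy]
        ring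

/-- Monsky's theorem for a drawing of the triangulation over a field with a valuation. -/
theorem exists_le_valuation_doubleArea {Γ : Type*} [LinearOrderedCommGroupWithZero Γ]
    (v : Valuation K Γ)
    (hx : x (T.corner 2) = x (T.corner 1) + x (T.corner 3) - x (T.corner 0))
    (hy : y (T.corner 2) = y (T.corner 1) + y (T.corner 3) - y (T.corner 0))
    (hD : doubleArea x y (T.corner 0) (T.corner 1) (T.corner 3) ≠ 0) :
    ∃ j, 1 ≤ v (doubleArea x y (T.tri j 0) (T.tri j 1) (T.tri j 2) /
      doubleArea x y (T.corner 0) (T.corner 1) (T.corner 3)) := by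
  set D := doubleArea x y (T.corner 0) (T.corner 1) (T.corner 3) with hD'
  -- Cramer's rule: the affine coordinates sending corners 0, 1, 3 to (0,0), (1,0), (0,1).
  let X : V → K := fun a => doubleArea x y (T.corner 0) a (T.corner 3) / D
  let Y : V → K := fun a => doubleArea x y (T.corner 0) (T.corner 1) a / D
  have hX0 : X (T.corner 0) = 0 := by simp [X, doubleArea]
  have hY0 : Y (T.corner 0) = 0 := by simp [Y, doubleArea]
  have hX1 : X (T.corner 1) = 1 := div_self hD
  have hY1 : Y (T.corner 1) = 0 := by simp [Y, doubleArea, mul_comm]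
  have hX3 : X (T.corner 3) = 0 := by simp [X, doubleArea, mul_comm]
  have hY3 : Y (T.corner 3) = 1 := div_self hD
  have hX2 : X (T.corner 2) = 1 := by
    rw [← div_self hD]
    simp only [X]
    congr 1
    rw [hD', doubleArea, doubleArea, hx, hy]
    ring
  have hY2 : Y (T.corner 2) = 1 := by
    rw [← div_self hD]
    simp only [Y]
    congr 1
    rw [hD', doubleArea, doubleArea, hx, hy]
    ring
  have hXY (a b c : V) : (X b - X a) * (Y c - Y a) - (X c - X a) * (Y b - Y a) =
      doubleArea x y a b c / D := by
    simp only [X, Y]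
    field_simp
    rw [hD']
    simp only [doubleArea]
    ring
  obtain ⟨j, hj⟩ := T.exists_rainbow (fun a => v.planeColor (X a) (Y a))
    (by simp [hX0, hY0, Valuation.planeColor]) (by simp [hX1, hY1, Valuation.planeColor])
    (by simp [hX2, hY2, Valuation.planeColor]) (by simp [hX3, hY3, Valuation.planeColor])
  refine ⟨j, ?_⟩
  obtain ⟨a, ha⟩ := hj 0
  obtain ⟨b, hb⟩ := hj 1
  obtain ⟨c, hc⟩ := hj 2
  have hab : a ≠ b := by rintro rfl; simp [ha] at hb
  have hac : a ≠ c := by rintro rfl; simp [ha] at hc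
  have hbc : b ≠ c := by rintro rfl; simp [hb] at hc
  have h := v.one_le_of_planeColor ha hb hc
  rw [hXY] at h
  -- The colours may run against the orientation; the valuation ignores the sign.
  have hperm : doubleArea x y (T.tri j a) (T.tri j b) (T.tri j c) =
        doubleArea x y (T.tri j 0) (T.tri j 1) (T.tri j 2) ∨
      doubleArea x y (T.tri j a) (T.tri j b) (T.tri j c) =
        -doubleArea x y (T.tri j 0) (T.tri j 1) (T.tri j 2) := by
    have key : ∀ a b c : Fin 3, a ≠ b → a ≠ c → b ≠ c →
        (a = 0 ∧ b = 1 ∧ c = 2 ∨ a = 1 ∧ b = 2 ∧ c = 0 ∨ a = 2 ∧ b = 0 ∧ c = 1) ∨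
          (a = 0 ∧ b = 2 ∧ c = 1 ∨ a = 1 ∧ b = 0 ∧ c = 2 ∨ a = 2 ∧ b = 1 ∧ c = 0) := by
      decide
    refine (key a b c hab hac hbc).imp ?_ ?_ <;>
      · rintro (⟨rfl, rfl, rfl⟩ | ⟨rfl, rfl, rfl⟩ | ⟨rfl, rfl, rfl⟩) <;>
          · unfold doubleArea
            ring
  rcases hperm with e | e <;> simpa [e, neg_div, Valuation.map_neg] using h

end Field

/-! ### The generic drawing -/

/-- The coordinates of a vertex in the function field. -/
noncomputable def fieldCoord (c : Fin 2) (a : V) : T.FunctionField :=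
  algebraMap T.CoordRing T.FunctionField (T.coord c a)

theorem fieldCoord_corner_two (c : Fin 2) :
    T.fieldCoord c (T.corner 2) =
      T.fieldCoord c (T.corner 1) + T.fieldCoord c (T.corner 3) - T.fieldCoord c (T.corner 0) := by
  have h1 : T.corner 1 ≠ T.corner 2 := T.corner_injective.ne (by decide)
  have h3 : T.corner 3 ≠ T.corner 2 := T.corner_injective.ne (by decide)
  have h0 : T.corner 0 ≠ T.corner 2 := T.corner_injective.ne (by decide)
  simp [fieldCoord, coord, h0, h1, h3]

theorem Z_eq (j : Fin T.n) :
    T.Z j = doubleArea (T.fieldCoord 0) (T.fieldCoord 1) (T.tri j 0) (T.tri j 1) (T.tri j 2) / 2 := by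
  have h2 : algebraMap T.CoordRing T.FunctionField (MvPolynomial.C (1 / 2)) = 1 / 2 := by
    rw [eq_div_iff two_ne_zero, ← map_ofNat (algebraMap T.CoordRing T.FunctionField) 2, ← map_mul,
      ← map_ofNat MvPolynomial.C 2, ← map_mul]
    norm_num
  rw [Z, areaPoly, map_mul, h2, Matrix.det_fin_three]
  simp [doubleArea, fieldCoord]
  ring

theorem sigma_eq : T.sigma =
    doubleArea (T.fieldCoord 0) (T.fieldCoord 1) (T.corner 0) (T.corner 1) (T.corner 3) := by
  simp only [sigma, Z_eq]
  rw [← Finset.sum_div, T.sum_doubleArea _ _ (T.fieldCoord_corner_two 0) (T.fieldCoord_corner_two 1)]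
  exact mul_div_cancel_left₀ _ two_ne_zero

/-- `σ` is a doubled triangle area while `Z j` is an undoubled one; this factor 2 makes Monsky's
bound strict. -/
theorem exists_one_lt_valuation (hσ : T.sigma ≠ 0) {Γ : Type*} [LinearOrderedCommGroupWithZero Γ]
    (v : Valuation T.FunctionField Γ) (h2 : v 2 < 1) : ∃ j, 1 < v (T.Z j / T.sigma) := by
  rw [T.sigma_eq] at hσ ⊢
  obtain ⟨j, hj⟩ := T.exists_le_valuation_doubleArea _ _ v (T.fieldCoord_corner_two 0)
    (T.fieldCoord_corner_two 1) hσ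
  refine ⟨j, ?_⟩
  rw [T.Z_eq, div_right_comm, map_div₀]
  have h0 : 0 < v 2 := (Valuation.pos_iff v).2 two_ne_zero
  exact (one_lt_div₀ h0).2 (h2.trans_le hj)

/-- One half is an integral polynomial in the normalized areas. -/
theorem exists_two_mul_aeval_eq_one (hσ : T.sigma ≠ 0) :
    ∃ g : MvPolynomial (Fin T.n) ℤ, 2 * MvPolynomial.aeval (fun j => T.Z j / T.sigma) g = 1 := by
  set φ : MvPolynomial (Fin T.n) ℤ →ₐ[ℤ] T.FunctionField :=
    MvPolynomial.aeval fun j => T.Z j / T.sigma with hφ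
  let A : Subring T.FunctionField := (φ : MvPolynomial (Fin T.n) ℤ →+* T.FunctionField).range
  by_cases hI : Ideal.span {(2 : A)} = ⊤
  · rw [Ideal.eq_top_iff_one, Ideal.mem_span_singleton'] at hI
    obtain ⟨⟨_, g, rfl⟩, hg⟩ := hI
    refine ⟨g, ?_⟩
    rw [mul_comm]
    exact congrArg Subtype.val hg
  -- A proper ideal lies in the nonunits of some valuation ring containing `A`.
  · obtain ⟨B, hAB, hB⟩ := Ideal.image_subset_nonunits_valuationSubring _ hI
    have h2 : B.valuation 2 < 1 :=
      (ValuationSubring.mem_nonunits_iff B).1 (hB ⟨2, Ideal.mem_span_singleton_self _, rfl⟩)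
    obtain ⟨j, hj⟩ := T.exists_one_lt_valuation hσ B.valuation h2
    have hjA : T.Z j / T.sigma ∈ A := ⟨MvPolynomial.X j, by simp [hφ]⟩
    exact absurd ((B.valuation_le_one_iff _).2 (hAB hjA)) hj.not_ge

end SquareTriangulation

theorem mainTheorem1 {V : Type*} [Fintype V] (T : SquareTriangulation V) :
    ∃ (e : ℕ) (f : MvPolynomial (Fin T.n) ℤ),
      f.IsHomogeneous e ∧ 2 * MvPolynomial.aeval T.Z f = T.sigma ^ e := by
  by_cases hσ : T.sigma = 0
  -- Degree 1 rather than 0, since `σ ^ 0 = 1`.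
  · exact ⟨1, 0, MvPolynomial.isHomogeneous_zero _ _ _, by simp [hσ]⟩
  · obtain ⟨g, hg⟩ := T.exists_two_mul_aeval_eq_one hσ
    obtain ⟨e, f, hf, h⟩ := exists_isHomogeneous_aeval_eq T.Z hσ g
    refine ⟨e, f, hf, ?_⟩
    rw [h, mul_left_comm]
    exact (congrArg (T.sigma ^ e * ·) hg).trans (mul_one _)
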